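/- Let $1<\beta\le 2$, $\alpha=\beta-1$, $z_0\in(0,1)$. Write $\|f\|=\sup_{[0,1]}|f|$ and let $\mathcal H(\beta)$ be the set of $S\in C^1([0,1],\mathbb R)$ whose derivative is Hölder continuous of exponent $\alpha$. For $0<\delta<1$ let $$\mathcal U_{z_0,\delta}=\Big\{S\in\mathcal H(\beta):\ \|S'\|\le\delta^{-1},\ \Big|\int_{-1}^{1}\big(S(z_0+hu)-S(z_0)\big)du\Big|\le\delta h^{\beta}\ \text{ for all } h>0 \text{ with } [z_0-h,z_0+h]\subseteq[0,1]\Big\}.$$ One observes $y_k=S(x_k)+g(x_k,S)\xi_k$, $x_k=k/n$, $1\le k\le n$, where the $\xi_k$ are i.i.d. with an unknown density $p$ in $$\mathcal P_{\varepsilon,L}=\Big\{p:\ \int xp(x)\,dx=0,\ \int x^2p(x)\,dx=1,\ \int|x|^{2+\varepsilon}p(x)\,dx\le L\Big\};$$ here $\varepsilon>0$ and $L$ is so large that the standard Gaussian density belongs to $\mathcal P_{\varepsilon,L}$. Put $Q=\mathbf 1_{[-1,1]}$, $h_n=n^{-1/(2\beta+1)}$, $q_n=\sum_{k=1}^nQ\big(\frac{x_k-z_0}{h_n}\big)$,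 $\varphi_n=n^{\beta/(2\beta+1)}$. The function $g:[0,1]\times C^1([0,1],\mathbb R)\to(0,\infty)$ is assumed to satisfy: (a) $g_\star\le g(x,S)\le g^\star$ for all $x,S$, for some constants $0<g_\star\le g^\star<\infty$; (b) for every $0<\delta<1$, $$\lim_{n\to\infty}\sup_{S\in\mathcal U_{z_0,\delta}}\Big|\Big(\frac1{q_n}\sum_{k=1}^nQ\Big(\frac{x_k-z_0}{h_n}\Big)g^2(x_k,S)\Big)^{1/2}-g(z_0,S)\Big|=0;$$ (c) for each $S_0\in C^1([0,1],\mathbb R)$ there are linear forms $L_{x,S_0}$, $x\in[0,1]$, on $C^1([0,1],\mathbb R)$ and a constant $C_{S_0}$ such that $|L_{x,S_0}(f)|\le C_{S_0}\|f\|$ for all $x,f$, and $\sup_{x}|g(x,S_0+f)-g(x,S_0)-L_{x,S_0}(f)|/\|f\|\to0$ as $\|f\|\to0$. For an estimator $\tilde S_n$ of $S(z_0)$, that is, a function of $y_1,\dots,y_n$, let $$\tilde{\mathcal R}_{z_0,\delta}(\tilde S_n)=\sup_{p\in\mathcal P_{\varepsilon,L}}\ \sup_{S\in\mathcal U_{z_0,\delta}}\mathbb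 E\,\varphi_n\frac{|\tilde S_n-S(z_0)|}{g(z_0,S)} .$$ Then the kernel estimator $\hat S_n=\frac1{q_n}\sum_{k=1}^nQ\big(\frac{x_k-z_0}{h_n}\big)y_k$ satisfies $$\limsup_{\delta\to0}\ \limsup_{n\to\infty}\ \tilde{\mathcal R}_{z_0,\delta}(\hat S_n)\ \le\ \frac{\mathbb E|\eta|}{\sqrt2},\qquad \eta\sim\mathcal N(0,1),$$ and the constant is attained: for every $0<\delta<1$, $\liminf_{n\to\infty}\tilde{\mathcal R}_{z_0,\delta}(\hat S_n)\ge\mathbb E|\eta|/\sqrt2$. -/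

import Mathlib

open Set Filter Topology MeasureTheory ProbabilityTheory
open scoped ENNReal

noncomputable section

namespace HeteroReg

/-- The space `C¹([0,1], ℝ)` (one-sided derivatives at the end points), as a subspace of the
continuous functions on `[0,1]`. Its norm is the supremum norm `‖S‖ = sup |S|`. -/
def C1 : Submodule ℝ C(unitInterval, ℝ) where
  carrier := {f | ContDiffOn ℝ 1 (Set.IccExtend (zero_le_one' ℝ) f) (Set.Icc 0 1)}
  add_mem' := fun {_ _} hf hg => ContDiffOn.add hf hg
  zero_mem' := contDiffOn_const (c := (0 : ℝ))
  smul_mem' := fun c _ hf => ContDiffOn.const_smul c hf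

/-- `S` as a function of a real argument; only arguments in `[0,1]` are ever relevant. -/
def extend (S : C1) : ℝ → ℝ := Set.IccExtend (zero_le_one' ℝ) S.1

/-- The value `S(x)`, `x ∈ [0,1]`. -/
def value (S : C1) (x : unitInterval) : ℝ := S.1 x

/-- The derivative `S'(x)`, `x ∈ [0,1]` (one-sided at the end points). -/
def slope (S : C1) (x : unitInterval) : ℝ :=
  derivWithin (extend S) (Set.Icc 0 1) x

/-- The Hölder class `H(M, K, β)`, with `α = β - 1`. -/
def holderBall (M K β : ℝ) : Set C1 :=
  {S | (∀ x, |slope S x| ≤ M) ∧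
    ∀ x y : unitInterval, |slope S y - slope S x| ≤ K * |(x : ℝ) - y| ^ (β - 1)}

/-- `H(β)`, the union of the classes `H(M, K, β)` over `M > 0`, `K > 0`. -/
def holderClass (β : ℝ) : Set C1 :=
  ⋃ (M : ℝ) (_ : 0 < M) (K : ℝ) (_ : 0 < K), holderBall M K β

/-- The local weak Hölder class at `z₀`. The integral condition is imposed for every `h > 0` for
which it makes sense, that is, such that `[z₀ - h, z₀ + h] ⊆ [0,1]`. -/
def weakHolder (β : ℝ) (z₀ : unitInterval) (δ : ℝ) : Set C1 :=
  {S | S ∈ holderClass β ∧ (∀ x, |slope S x| ≤ δ⁻¹) ∧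
    ∀ h : ℝ, 0 < h → 0 ≤ z₀ - h → z₀ + h ≤ 1 →
      |∫ u in (-1 : ℝ)..1, (extend S (z₀ + h * u) - value S z₀)| ≤ δ * h ^ β}

/-- The regressors `x_k = k / n`, `k = 1, …, n` (the index `k : Fin n` stands for `k + 1`). -/
def design (n : ℕ) (k : Fin n) : unitInterval :=
  ⟨((k : ℝ) + 1) / n, by
    have hk : ((k : ℕ) : ℝ) + 1 ≤ n := by exact_mod_cast k.2
    exact ⟨by positivity, div_le_one_of_le₀ hk (by positivity)⟩⟩

/-- The kernel `Q`, the indicator function of `[-1, 1]`. -/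
def kernel : ℝ → ℝ := Set.indicator (Set.Icc (-1) 1) fun _ => 1

/-- The bandwidth `h = n ^ (-1 / (2β + 1))`. -/
def bandwidth (β : ℝ) (n : ℕ) : ℝ := (n : ℝ) ^ (-1 / (2 * β + 1))

/-- The normalization `φ_n = n ^ (β / (2β + 1))`. -/
def rate (β : ℝ) (n : ℕ) : ℝ := (n : ℝ) ^ (β / (2 * β + 1))

/-- The kernel weight `Q((x_k - z₀) / h)`. -/
def weight (β : ℝ) (z₀ : unitInterval) (n : ℕ) (k : Fin n) : ℝ :=
  kernel (((design n k : ℝ) - z₀) / bandwidth β n)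

/-- `q_n = ∑ Q((x_k - z₀) / h)`. -/
def totalWeight (β : ℝ) (z₀ : unitInterval) (n : ℕ) : ℝ := ∑ k, weight β z₀ n k

/-- The kernel estimator of `S(z₀)`, as a function of the observations `y_1, …, y_n`. -/
def kernelEstimator (β : ℝ) (z₀ : unitInterval) (n : ℕ) (y : Fin n → ℝ) : ℝ :=
  (1 / totalWeight β z₀ n) * ∑ k, weight β z₀ n k * y k

/-- The standing assumptions on the scale functional `g : [0,1] × C¹([0,1], ℝ) → (0, ∞)`. -/
structure IsScale (β : ℝ) (z₀ : unitInterval) (g : unitInterval → C1 → ℝ) : Prop where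
  /-- `g` is bounded, and bounded away from zero. -/
  bounds : ∃ gmin gmax : ℝ, 0 < gmin ∧ ∀ x S, gmin ≤ g x S ∧ g x S ≤ gmax
  /-- For every `0 < δ < 1`, the local averages of `g²` approach `g²(z₀, S)`, in the sense that
  `sup_S |((1/q_n) ∑ Q((x_k - z₀)/h) g²(x_k, S))^(1/2) - g(z₀, S)| → 0`, the supremum being over
  the local weak Hölder class. -/
  average : ∀ δ : ℝ, 0 < δ → δ < 1 →
    TendstoUniformlyOn
      (fun (n : ℕ) (S : C1) =>
        √((1 / totalWeight β z₀ n) * ∑ k, weight β z₀ n k * g (design n k) S ^ 2))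
      (fun S => g z₀ S) atTop (weakHolder β z₀ δ)
  /-- `g` is Fréchet differentiable in `S` with respect to the supremum norm, uniformly over `x`,
  with derivatives `L x` that are bounded uniformly over `x`. -/
  frechet : ∀ S₀ : C1, ∃ L : unitInterval → C1 →ₗ[ℝ] ℝ,
    (∃ C : ℝ, 0 < C ∧ ∀ x S, |L x S| ≤ C * ‖S‖) ∧
    ∀ r : ℝ, 0 < r → ∃ η : ℝ, 0 < η ∧ ∀ f : C1, ‖f‖ ≤ η →
      ∀ x, |g x (S₀ + f) - g x S₀ - L x f| ≤ r * ‖f‖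

/-- The class of probability densities on the real line with mean `0`, variance `1` and absolute
moment of order `2 + ε` at most `L`. -/
structure IsNoiseDensity (ε L : ℝ) (p : ℝ → ℝ) : Prop where
  measurable : Measurable p
  nonneg : ∀ x, 0 ≤ p x
  integrable : Integrable p
  integral_eq_one : ∫ x, p x = 1
  integrable_mean : Integrable fun x => x * p x
  mean_eq_zero : ∫ x, x * p x = 0
  integrable_sq : Integrable fun x => x ^ 2 * p x
  sq_eq_one : ∫ x, x ^ 2 * p x = 1
  integrable_moment : Integrable fun x => |x| ^ (2 + ε) * p x
  moment_le : ∫ x, |x| ^ (2 + ε) * p x ≤ L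

/-- The distribution with density `p`. -/
def noiseLaw (p : ℝ → ℝ) : Measure ℝ := volume.withDensity fun x => ENNReal.ofReal (p x)

/-- The law of the observations `y_k = S(x_k) + g(x_k, S) ξ_k`, `k = 1, …, n`, when the `ξ_k` are
independent with density `p`. -/
def obsLaw (g : unitInterval → C1 → ℝ) (p : ℝ → ℝ) (S : C1) (n : ℕ) : Measure (Fin n → ℝ) :=
  (Measure.pi fun _ : Fin n => noiseLaw p).map
    fun ξ k => value S (design n k) + g (design n k) S * ξ k

/-- The maximal normalized absolute error risk of an estimator `T` of `S(z₀)`, over all noise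
densities in the class and all `S` in the local weak Hölder class. -/
def risk (β : ℝ) (z₀ : unitInterval) (g : unitInterval → C1 → ℝ) (ε L δ : ℝ) (n : ℕ)
    (T : (Fin n → ℝ) → ℝ) : ℝ≥0∞ :=
  ⨆ (p : ℝ → ℝ) (_ : IsNoiseDensity ε L p) (S : C1) (_ : S ∈ weakHolder β z₀ δ),
    ∫⁻ y, ENNReal.ofReal (rate β n * (|T y - value S z₀| / g z₀ S)) ∂(obsLaw g p S n)

/-- The constant `E|η| / √2`, with `η` standard Gaussian. -/
def sharpConstant : ℝ≥0∞ := ENNReal.ofReal ((∫ x, |x| ∂(gaussianReal 0 1)) / √2)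

end HeteroReg

end

/-! The normalized error of the kernel estimator is affine in the noise: `normalizedBias` plus `∑ k,
noiseCoeff k * ξ k`. Everything reduces to controlling this bias and these coefficients uniformly
over the regression functions, and to a central limit theorem for first absolute moments that is
uniform over the noise laws.

Bias: the weighted sum is a Riemann sum of the integral that the weak Hölder condition bounds by `δ
h^β`. Since `φ_n h^β = 1` and `φ_n² / q_n → 1/2`, the normalized bias is at most a multiple of `δ`
plus `o(1)` (`eventually_normalizedBias_le`). It disappears only in the outer limit `δ → 0`.

Noise: the coefficients tend to zero uniformly, and the sum of their squares tends to `1/2`, by the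
local averaging assumption on `g²` and `φ_n² / q_n → 1/2`. Lindeberg's replacement method, applied
to the smoothing `√(x² + s²)` of `|x|`, gives `abs_integral_abs_sub_le`; the error depends on the
law only through its moment of order `2 + ε`. The mean absolute noise term therefore tends to `E|η|
/ √2` uniformly.

The upper bound is the triangle inequality. For the lower bound the single pair `S = 0`, `p`
Gaussian suffices: the zero function lies in every class and has no bias. -/

noncomputable section

namespace HeteroReg

/-! ### A smooth approximation of the absolute value -/

/-- The function `√(x² + s²)`. -/
def smoothAbs (s x : ℝ) : ℝ := √(x ^ 2 + s ^ 2)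

lemma smoothAbs_pos {s : ℝ} (hs : 0 < s) (x : ℝ) : 0 < smoothAbs s x :=
  Real.sqrt_pos.2 (by positivity)

lemma smoothAbs_sq (s x : ℝ) : smoothAbs s x ^ 2 = x ^ 2 + s ^ 2 :=
  Real.sq_sqrt (by positivity)

lemma le_smoothAbs {s : ℝ} (x : ℝ) : s ≤ smoothAbs s x :=
  Real.le_sqrt_of_sq_le (by nlinarith [sq_nonneg x])

lemma abs_le_smoothAbs (s x : ℝ) : |x| ≤ smoothAbs s x :=
  Real.abs_le_sqrt (by nlinarith [sq_nonneg s])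

lemma smoothAbs_le {s : ℝ} (hs : 0 < s) (x : ℝ) : smoothAbs s x ≤ |x| + s :=
  Real.sqrt_le_iff.2 ⟨by positivity, by nlinarith [abs_nonneg x, sq_abs x]⟩

lemma hasDerivAt_smoothAbs {s : ℝ} (hs : 0 < s) (x : ℝ) :
    HasDerivAt (smoothAbs s) (x / smoothAbs s x) x := by
  have h : HasDerivAt (fun x : ℝ => x ^ 2 + s ^ 2) (2 * x) x := by
    simpa using (hasDerivAt_pow 2 x).add_const (s ^ 2)
  have := h.sqrt (by positivity)
  rwa [mul_div_mul_left _ _ two_ne_zero] at this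

lemma hasDerivAt_deriv_smoothAbs {s : ℝ} (hs : 0 < s) (x : ℝ) :
    HasDerivAt (fun x => x / smoothAbs s x) (s ^ 2 / smoothAbs s x ^ 3) x := by
  have h0 := (smoothAbs_pos hs x).ne'
  have h2 := smoothAbs_sq s x
  refine ((hasDerivAt_id' x).fun_div (hasDerivAt_smoothAbs hs x) h0).congr_deriv ?_
  field_simp
  linarith

lemma lipschitzWith_smoothAbs {s : ℝ} (hs : 0 < s) : LipschitzWith 1 (smoothAbs s) := by
  refine lipschitzWith_of_nnnorm_deriv_le (fun x => (hasDerivAt_smoothAbs hs x).differentiableAt)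
    fun x => ?_
  rw [(hasDerivAt_smoothAbs hs x).deriv, ← NNReal.coe_le_coe, coe_nnnorm, Real.norm_eq_abs, abs_div,
    abs_of_pos (smoothAbs_pos hs x)]
  exact div_le_one_of_le₀ (abs_le_smoothAbs s x) (smoothAbs_pos hs x).le

/-- The second derivative is bounded by `1 / s` and Lipschitz with constant `3 / s²`. A bounded
Lipschitz function is Hölder of every exponent `r ∈ [0,1]`: the Lipschitz bound serves when `|u - v|
≤ 1`, boundedness otherwise. -/
lemma abs_sub_deriv_deriv_smoothAbs_le {s r : ℝ} (hs : 0 < s) (hr : 0 ≤ r) (hr1 : r ≤ 1) (u v : ℝ) :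
    |s ^ 2 / smoothAbs s u ^ 3 - s ^ 2 / smoothAbs s v ^ 3| ≤ (1 / s + 3 / s ^ 2) * |u - v| ^ r := by
  set A := smoothAbs s u with hA
  set B := smoothAbs s v with hB
  have hAs : s ≤ A := le_smoothAbs u
  have hBs : s ≤ B := le_smoothAbs v
  have hA0 : 0 < A := hs.trans_le hAs
  have hB0 : 0 < B := hs.trans_le hBs
  have hAB : |A - B| ≤ |u - v| := by
    simpa [Real.dist_eq] using (lipschitzWith_smoothAbs hs).dist_le_mul u v
  have one_le (C : ℝ) (hC : s ≤ C) : s ^ 2 / C ^ 3 ≤ 1 / s := by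
    have hC0 : 0 < C := hs.trans_le hC
    rw [div_le_div_iff₀ (by positivity) hs]
    nlinarith [pow_le_pow_left₀ hs.le hC 3]
  rcases le_total |u - v| 1 with h | h
  · have key : s ^ 2 / A ^ 3 - s ^ 2 / B ^ 3
        = s ^ 2 * (B - A) * (1 / (A * B ^ 3) + 1 / (A ^ 2 * B ^ 2) + 1 / (A ^ 3 * B)) := by
      field_simp
      ring
    have b (i j : ℕ) (hij : i + j = 4) : 1 / (A ^ i * B ^ j) ≤ 1 / s ^ 4 := by
      rw [← hij, pow_add]
      gcongr
    have b1 := b 1 3 rfl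
    have b2 := b 2 2 rfl
    have b3 := b 3 1 rfl
    rw [pow_one] at b1 b3
    have h1 : |u - v| ≤ |u - v| ^ r := by
      simpa using Real.rpow_le_rpow_of_exponent_ge_of_imp (abs_nonneg (u - v)) h hr1 (by simp)
    calc |s ^ 2 / A ^ 3 - s ^ 2 / B ^ 3|
        = s ^ 2 * |A - B| * (1 / (A * B ^ 3) + 1 / (A ^ 2 * B ^ 2) + 1 / (A ^ 3 * B)) := by
          rw [key, abs_mul, abs_mul, abs_of_pos (pow_pos hs 2), abs_sub_comm B A,
            abs_of_pos (by positivity :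
              0 < 1 / (A * B ^ 3) + 1 / (A ^ 2 * B ^ 2) + 1 / (A ^ 3 * B))]
      _ ≤ s ^ 2 * |u - v| * (3 * (1 / s ^ 4)) := by gcongr; linarith
      _ = 3 / s ^ 2 * |u - v| := by field_simp
      _ ≤ (1 / s + 3 / s ^ 2) * |u - v| ^ r := by
          gcongr
          have : 0 < 1 / s := by positivity
          linarith
  · have h1 : 1 ≤ |u - v| ^ r := Real.one_le_rpow h hr
    have h2 : |s ^ 2 / A ^ 3 - s ^ 2 / B ^ 3| ≤ 1 / s :=
      abs_sub_le_of_nonneg_of_le (by positivity) (one_le A hAs) (by positivity) (one_le B hBs)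
    have h3 : 0 < 1 / s := by positivity
    have h4 : 0 < 3 / s ^ 2 := by positivity
    nlinarith

/-! ### Taylor expansion with Hölder second derivative -/

/-- The mean value inequality is applied twice on `[-|y|, |y|]`. The Hölder modulus yields a
remainder of order `|y|^(2+r)`, so no third moment of the noise is needed. -/
lemma abs_taylor_two_le {f f' f'' : ℝ → ℝ} {D r : ℝ} (hr : 0 ≤ r)
    (hf : ∀ x, HasDerivAt f (f' x) x) (hf' : ∀ x, HasDerivAt f' (f'' x) x)
    (hD : 0 ≤ D) (hf'' : ∀ u v, |f'' u - f'' v| ≤ D * |u - v| ^ r) (x y : ℝ) :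
    |f (x + y) - f x - f' x * y - f'' x * y ^ 2 / 2| ≤ D * |y| ^ r * y ^ 2 := by
  have shift {k k' : ℝ → ℝ} (hk : ∀ x, HasDerivAt k (k' x) x) (t : ℝ) :
      HasDerivAt (fun t => k (x + t)) (k' (x + t)) t := by
    simpa using (hk (x + t)).comp_const_add x t
  have hconv : Convex ℝ (Icc (-|y|) |y|) := convex_Icc _ _
  have h0 : (0 : ℝ) ∈ Icc (-|y|) |y| := by simp
  have hy : y ∈ Icc (-|y|) |y| := ⟨neg_abs_le y, le_abs_self y⟩
  have h1 (t : ℝ) (ht : t ∈ Icc (-|y|) |y|) :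
      ‖f' (x + t) - f' x - f'' x * t‖ ≤ D * |y| ^ r * |y| := by
    have := hconv.norm_image_sub_le_of_norm_hasDerivWithin_le
      (f := fun t => f' (x + t) - f'' x * t) (f' := fun t => f'' (x + t) - f'' x)
      (C := D * |y| ^ r) (fun t _ => by
        simpa using ((shift hf' t).fun_sub ((hasDerivAt_id t).const_mul (f'' x))).hasDerivWithinAt)
      (fun t ht => by
        refine (hf'' _ _).trans ?_
        have : |t| ≤ |y| := abs_le.2 ht
        simp only [add_sub_cancel_left]
        gcongr) h0 ht
    simp only [add_zero, mul_zero, sub_zero] at this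
    rw [show f' (x + t) - f' x - f'' x * t = f' (x + t) - f'' x * t - f' x by ring]
    refine this.trans ?_
    have : ‖t‖ ≤ |y| := abs_le.2 ht
    gcongr
  have := hconv.norm_image_sub_le_of_norm_hasDerivWithin_le
    (f := fun t => f (x + t) - f' x * t - f'' x * t ^ 2 / 2)
    (f' := fun t => f' (x + t) - f' x - f'' x * t)
    (C := D * |y| ^ r * |y|) (fun t _ => by
      have h2 := ((hasDerivAt_pow 2 t).const_mul (f'' x)).div_const 2
      have h3 := ((shift hf t).fun_sub ((hasDerivAt_id' t).const_mul (f' x))).fun_sub h2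
      refine HasDerivAt.hasDerivWithinAt ?_
      convert h3 using 1
      push_cast
      ring) h1 h0 hy
  simp only [add_zero, mul_zero, sub_zero, Real.norm_eq_abs] at this
  rw [show f (x + y) - f x - f' x * y - f'' x * y ^ 2 / 2
    = f (x + y) - f' x * y - f'' x * y ^ 2 / 2 - f x by ring]
  rw [← sq_abs y]
  calc _ ≤ _ := by simpa using this
    _ = _ := by ring

/-! ### The Lindeberg comparison -/

/-- Probability measures on the line with mean `0`, variance `1` and absolute moment of order
`2 + r` at most `M`. -/
structure IsStandardized (r M : ℝ) (μ : Measure ℝ) : Prop where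
  isProbabilityMeasure : IsProbabilityMeasure μ
  integrable : Integrable (fun x => x) μ
  mean : ∫ x, x ∂μ = 0
  integrable_sq : Integrable (fun x => x ^ 2) μ
  sq : ∫ x, x ^ 2 ∂μ = 1
  integrable_moment : Integrable (fun x => |x| ^ (2 + r)) μ
  moment : ∫ x, |x| ^ (2 + r) ∂μ ≤ M

/-- Follows from `|x|^(2+r') ≤ 1 + |x|^(2+r)`. It allows `r ≤ 1` to be assumed later, as the Hölder
estimate for the second derivative requires. -/
lemma IsStandardized.mono {r r' M : ℝ} {μ : Measure ℝ} (h : IsStandardized r M μ) (hr' : 0 ≤ r')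
    (hrr : r' ≤ r) : IsStandardized r' (1 + M) μ := by
  have := h.isProbabilityMeasure
  have hle (x : ℝ) : |x| ^ (2 + r') ≤ 1 + |x| ^ (2 + r) := by
    rcases le_total |x| 1 with hx | hx
    · have h1 := Real.rpow_le_one (abs_nonneg x) hx (by linarith : 0 ≤ 2 + r')
      have h2 := Real.rpow_nonneg (abs_nonneg x) (2 + r)
      linarith
    · have := Real.rpow_le_rpow_of_exponent_le hx (by linarith : 2 + r' ≤ 2 + r)
      linarith
  have hi : Integrable (fun x : ℝ => 1 + |x| ^ (2 + r)) μ :=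
    (integrable_const 1).add h.integrable_moment
  have hi' : Integrable (fun x : ℝ => |x| ^ (2 + r')) μ := by
    refine hi.mono' (by have : 0 ≤ 2 + r' := by linarith
                        fun_prop (disch := assumption)) (ae_of_all _ fun x => ?_)
    rw [Real.norm_of_nonneg (by positivity)]
    exact hle x
  refine ⟨h.isProbabilityMeasure, h.integrable, h.mean, h.integrable_sq, h.sq, hi', ?_⟩
  calc _ ≤ ∫ x, (1 + |x| ^ (2 + r)) ∂μ := integral_mono hi' hi hle
    _ = 1 + ∫ x, |x| ^ (2 + r) ∂μ := by
      rw [integral_add (integrable_const 1) h.integrable_moment]; simp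
    _ ≤ 1 + M := by linarith [h.moment]

lemma integrable_comp_of_lipschitz {Ω : Type*} [MeasurableSpace Ω] {P : Measure Ω}
    [IsFiniteMeasure P] {f : ℝ → ℝ} (hf : LipschitzWith 1 f) {X : Ω → ℝ} (hX : Integrable X P) :
    Integrable (fun ω => f (X ω)) P := by
  refine ((integrable_const |f 0|).add hX.abs).mono'
    (hf.continuous.comp_aestronglyMeasurable hX.1) (ae_of_all _ fun ω => ?_)
  have := hf.dist_le_mul (X ω) 0
  simp only [Real.dist_eq, NNReal.coe_one, one_mul, sub_zero] at this
  have h2 := abs_sub_abs_le_abs_sub (f (X ω)) (f 0)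
  simp only [Real.norm_eq_abs, Pi.add_apply]
  linarith

/-- The basis of Lindeberg's method: mean `0` and variance `1` make the second-order expansion the
same for all standardized laws, so exchanging one law for another costs only the two remainders. -/
lemma abs_integral_sub_taylor_le {f f' f'' : ℝ → ℝ} {D r M : ℝ} (hr : 0 ≤ r)
    (hlip : LipschitzWith 1 f)
    (hf : ∀ x, HasDerivAt f (f' x) x) (hf' : ∀ x, HasDerivAt f' (f'' x) x)
    (hD : 0 ≤ D) (hf'' : ∀ u v, |f'' u - f'' v| ≤ D * |u - v| ^ r)
    {μ : Measure ℝ} (hμ : IsStandardized r M μ) (x a : ℝ) :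
    |∫ y, f (x + a * y) ∂μ - (f x + f'' x * a ^ 2 / 2)| ≤ D * M * |a| ^ (2 + r) := by
  have := hμ.isProbabilityMeasure
  have hi : Integrable (fun y => f (x + a * y)) μ :=
    integrable_comp_of_lipschitz hlip ((integrable_const x).add (hμ.integrable.const_mul a))
  have hi1 : Integrable (fun y => f (x + a * y) - f x) μ := hi.sub (integrable_const _)
  have hi2 : Integrable (fun y => f' x * (a * y)) μ := (hμ.integrable.const_mul a).const_mul _
  have hi3 : Integrable (fun y => f'' x * (a * y) ^ 2 / 2) μ := by
    have := hμ.integrable_sq.const_mul (f'' x * a ^ 2 / 2)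
    refine this.congr (ae_of_all _ fun y => ?_)
    simp only
    ring
  have h2 : ∫ y, f'' x * (a * y) ^ 2 / 2 ∂μ = f'' x * a ^ 2 / 2 := by
    rw [← mul_one (f'' x * a ^ 2 / 2), ← hμ.sq, ← integral_const_mul]
    congr 1 with y
    ring
  have key : ∫ y, f (x + a * y) ∂μ - (f x + f'' x * a ^ 2 / 2)
      = ∫ y, (f (x + a * y) - f x - f' x * (a * y) - f'' x * (a * y) ^ 2 / 2) ∂μ := by
    rw [integral_sub (by exact hi1.sub hi2) hi3, integral_sub hi1 hi2,
      integral_sub hi (integrable_const _), h2, integral_const_mul, integral_const_mul, hμ.mean]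
    simp
    ring
  rw [key, ← Real.norm_eq_abs]
  calc _ ≤ ∫ y, D * |a| ^ (2 + r) * |y| ^ (2 + r) ∂μ := by
        refine norm_integral_le_of_norm_le (hμ.integrable_moment.const_mul _)
          (ae_of_all _ fun y => ?_)
        refine (abs_taylor_two_le hr hf hf' hD hf'' x (a * y)).trans_eq ?_
        have h0 : (0 : ℝ) ≤ |a * y| := abs_nonneg _
        rw [mul_assoc, mul_assoc, ← Real.mul_rpow (abs_nonneg _) (abs_nonneg _), ← abs_mul,
          Real.rpow_add_of_nonneg h0 zero_le_two hr, Real.rpow_two, sq_abs, mul_comm (_ ^ r)]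
    _ = D * |a| ^ (2 + r) * ∫ y, |y| ^ (2 + r) ∂μ := integral_const_mul _ _
    _ ≤ D * |a| ^ (2 + r) * M := by gcongr; exact hμ.moment
    _ = _ := by ring

lemma integrable_linear_pi {μ : Measure ℝ} [IsProbabilityMeasure μ]
    (hμ : Integrable (fun x => x) μ) {n : ℕ} (a : Fin n → ℝ) (x : ℝ) :
    Integrable (fun ξ : Fin n → ℝ => x + ∑ k, a k * ξ k) (Measure.pi fun _ => μ) :=
  (integrable_const x).add (integrable_finsetSum _ fun k _ =>
    (integrable_comp_eval (μ := fun _ : Fin n => μ) (i := k) hμ).const_mul (a k))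

lemma integrable_id_gaussianReal (v : NNReal) : Integrable (fun x => x) (gaussianReal 0 v) := by
  have := memLp_id_gaussianReal (μ := 0) (v := v) 1
  exact (memLp_one_iff_integrable.1 (by simpa using! this))

/-- Adding an independent centred Gaussian variable adds the variances. -/
lemma integral_integral_gaussianReal {f : ℝ → ℝ} (hlip : LipschitzWith 1 f) (x a : ℝ)
    (v : NNReal) :
    ∫ y, ∫ z, f (x + y + a * z) ∂(gaussianReal 0 1) ∂(gaussianReal 0 v)
      = ∫ y, f (x + y) ∂(gaussianReal 0 (v + ‖a‖₊ ^ 2)) := by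
  have h1 : gaussianReal 0 (v + ‖a‖₊ ^ 2)
      = (gaussianReal 0 v) ∗ ((gaussianReal 0 1).map (a * ·)) := by
    rw [gaussianReal_map_const_mul, gaussianReal_conv_gaussianReal]
    congr 1
    · simp
    · ext; simp
  have hi : Integrable (fun y => f (x + y))
      ((gaussianReal 0 v) ∗ ((gaussianReal 0 1).map (a * ·))) := by
    rw [← h1]
    exact integrable_comp_of_lipschitz hlip
      ((integrable_const x).add (integrable_id_gaussianReal _))
  rw [h1, integral_conv hi]
  congr 1 with y
  rw [integral_map (by fun_prop) (by have := hlip.continuous; fun_prop)]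
  simp only [add_assoc]

/-- Lindeberg replacement by induction on the number of variables. The last `n` are replaced by one
Gaussian variable of their total variance, then the first one by an independent Gaussian, which is
absorbed by convolution. The base point `x` varies in the induction because it takes up the first
variable. The factor `2` counts the Taylor remainders of `μ` and of the Gaussian law. -/
lemma abs_integral_pi_sub_gaussianReal_le {f f' f'' : ℝ → ℝ} {D r M : ℝ} (hr : 0 ≤ r)
    (hlip : LipschitzWith 1 f)
    (hf : ∀ x, HasDerivAt f (f' x) x) (hf' : ∀ x, HasDerivAt f' (f'' x) x)
    (hD : 0 ≤ D) (hf'' : ∀ u v, |f'' u - f'' v| ≤ D * |u - v| ^ r)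
    {μ : Measure ℝ} (hμ : IsStandardized r M μ) (hγ : IsStandardized r M (gaussianReal 0 1))
    {n : ℕ} (a : Fin n → ℝ) (x : ℝ) :
    |∫ ξ, f (x + ∑ k, a k * ξ k) ∂(Measure.pi fun _ => μ)
      - ∫ y, f (x + y) ∂(gaussianReal 0 (∑ k, ‖a k‖₊ ^ 2))|
      ≤ ∑ k, 2 * (D * M) * |a k| ^ (2 + r) := by
  have := hμ.isProbabilityMeasure
  induction n generalizing x with
  | zero => simp [gaussianReal_zero_var]
  | succ n ih =>
    set b : Fin n → ℝ := fun k => a k.succ with hb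
    set v : NNReal := ∑ k, ‖b k‖₊ ^ 2 with hv
    set γ := gaussianReal 0 v with hγv
    have hint := integrable_comp_of_lipschitz hlip (integrable_linear_pi hμ.integrable a x)
    have hmp := (measurePreserving_piFinSuccAbove (fun _ : Fin (n + 1) => μ) 0).symm
    have hint' := (hmp.integrable_comp_emb (MeasurableEquiv.measurableEmbedding _)).2 hint
    have e1 : ∫ ξ, f (x + ∑ k, a k * ξ k) ∂(Measure.pi fun _ : Fin (n + 1) => μ)
        = ∫ t, ∫ ξ, f (x + a 0 * t + ∑ k, b k * ξ k) ∂(Measure.pi fun _ => μ) ∂μ := by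
      rw [← hmp.integral_comp']
      refine (integral_prod _ hint').trans ?_
      simp [Fin.sum_univ_succ, MeasurableEquiv.piFinSuccAbove, Fin.insertNthEquiv, hb, add_assoc]
    have hi1 : Integrable
        (fun t => ∫ ξ, f (x + a 0 * t + ∑ k, b k * ξ k) ∂(Measure.pi fun _ => μ)) μ := by
      have := hint'.integral_prod_left
      simpa [Fin.sum_univ_succ, MeasurableEquiv.piFinSuccAbove, Fin.insertNthEquiv, hb, add_assoc,
        Function.comp_def] using this
    have hprod (ν : Measure ℝ) [IsProbabilityMeasure ν] (hν : Integrable (fun t => t) ν) :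
        Integrable (fun p : ℝ × ℝ => f (x + a 0 * p.1 + p.2)) (ν.prod γ) := by
      refine integrable_comp_of_lipschitz hlip ?_
      exact ((integrable_const x).add ((hν.comp_fst γ).const_mul (a 0))).add
        ((integrable_id_gaussianReal v).comp_snd ν)
    have hi2 := (hprod μ hμ.integrable).integral_prod_left
    have hi3 := (hprod μ hμ.integrable).integral_prod_right
    have hi4 := (hprod _ hγ.integrable).integral_prod_right
    -- Induction hypothesis with base point `x + a 0 * t`, integrated over `t`.
    have step1 : |∫ t, ∫ ξ, f (x + a 0 * t + ∑ k, b k * ξ k) ∂(Measure.pi fun _ => μ) ∂μ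
        - ∫ t, ∫ y, f (x + a 0 * t + y) ∂γ ∂μ| ≤ ∑ k, 2 * (D * M) * |b k| ^ (2 + r) := by
      rw [← integral_sub hi1 hi2, ← Real.norm_eq_abs]
      refine (norm_integral_le_of_norm_le_const (ae_of_all _ fun t => ih b (x + a 0 * t))).trans ?_
      simp
    have e2 : ∫ t, ∫ y, f (x + a 0 * t + y) ∂γ ∂μ = ∫ y, ∫ t, f (x + a 0 * t + y) ∂μ ∂γ :=
      integral_integral_swap (hprod μ hμ.integrable)
    have e3 : ∫ y, f (x + y) ∂(gaussianReal 0 (∑ k, ‖a k‖₊ ^ 2))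
        = ∫ y, ∫ t, f (x + a 0 * t + y) ∂(gaussianReal 0 1) ∂γ := by
      rw [Fin.sum_univ_succ, add_comm, ← integral_integral_gaussianReal hlip]
      simp only [add_right_comm x]
      rfl
    -- After Fubini the Gaussian part `y` is frozen and only the law of the first variable changes.
    have step2 : |∫ y, ∫ t, f (x + a 0 * t + y) ∂μ ∂γ
        - ∫ y, ∫ t, f (x + a 0 * t + y) ∂(gaussianReal 0 1) ∂γ|
        ≤ 2 * (D * M) * |a 0| ^ (2 + r) := by
      rw [← integral_sub hi3 hi4, ← Real.norm_eq_abs]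
      refine (norm_integral_le_of_norm_le_const (C := 2 * (D * M) * |a 0| ^ (2 + r))
        (ae_of_all _ fun y => ?_)).trans ?_
      · have h1 := abs_integral_sub_taylor_le hr hlip hf hf' hD hf'' hμ (x + y) (a 0)
        have h2 := abs_integral_sub_taylor_le hr hlip hf hf' hD hf'' hγ (x + y) (a 0)
        simp only [add_right_comm x _ y, Real.norm_eq_abs]
        rw [abs_le] at *
        constructor <;> linarith
      · simp
    rw [e1, e3, Fin.sum_univ_succ]
    rw [e2] at step1
    rw [abs_le] at *
    constructor <;> linarith

/-- The first absolute moment of the standard Gaussian law. -/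
def gaussianAbsMoment : ℝ := ∫ x, |x| ∂(gaussianReal 0 1)

lemma gaussianAbsMoment_nonneg : 0 ≤ gaussianAbsMoment := integral_nonneg fun _ => abs_nonneg _

lemma integral_abs_gaussianReal (v : NNReal) :
    ∫ x, |x| ∂(gaussianReal 0 v) = √v * gaussianAbsMoment := by
  have h : gaussianReal 0 v = (gaussianReal 0 1).map (√v * ·) := by
    rw [gaussianReal_map_const_mul]
    congr 1
    · simp
    · ext; simp
  rw [h, integral_map (by fun_prop) (by fun_prop), gaussianAbsMoment, ← integral_const_mul]
  congr 1 with x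
  rw [abs_mul, abs_of_nonneg (Real.sqrt_nonneg _)]

/-- A central limit theorem for the first absolute moment, uniform over the class of laws and over
the coefficients. -/
theorem abs_integral_abs_sub_le {r M : ℝ} (hr : 0 < r)
    (hγ : IsStandardized r M (gaussianReal 0 1)) (K : ℝ) {τ : ℝ} (hτ : 0 < τ) :
    ∃ ρ : ℝ, 0 < ρ ∧ ∀ μ : Measure ℝ, IsStandardized r M μ → ∀ (n : ℕ) (a : Fin n → ℝ),
      (∀ k, |a k| ≤ ρ) → ∑ k, a k ^ 2 ≤ K →
      |∫ ξ, |∑ k, a k * ξ k| ∂(Measure.pi fun _ => μ)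
        - √(∑ k, a k ^ 2) * gaussianAbsMoment| ≤ τ := by
  wlog hr1 : r ≤ 1 generalizing r M
  · obtain ⟨ρ, hρ, h⟩ := this one_pos (hγ.mono zero_le_one (le_of_not_ge hr1)) le_rfl
    exact ⟨ρ, hρ, fun μ hμ => h μ (hμ.mono zero_le_one (le_of_not_ge hr1))⟩
  -- Smoothing costs at most `s = τ / 4` and the replacement at most `τ / 2`.
  set s := τ / 4 with hs
  have hs0 : 0 < s := by positivity
  set D := 1 / s + 3 / s ^ 2 with hD
  have hD0 : 0 < D := by positivity
  have hM : 0 ≤ M := (integral_nonneg fun x => by positivity).trans hγ.moment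
  -- From `|a k|^(2+r) ≤ ρ^r * a k ^ 2`, the total replacement error is at most `2 D M ρ^r |K|`,
  -- whatever `n` is.
  obtain ⟨ρ, hρ0, hρ⟩ : ∃ ρ : ℝ, 0 < ρ ∧ 2 * (D * M) * ρ ^ r * |K| ≤ τ / 2 := by
    have h1 : Tendsto (fun ρ : ℝ => 2 * (D * M) * ρ ^ r * |K|) (𝓝[>] 0) (𝓝 0) := by
      have : ContinuousAt (fun ρ : ℝ => 2 * (D * M) * ρ ^ r * |K|) 0 := by
        have := Real.continuousAt_rpow_const 0 r (Or.inr hr.le)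
        fun_prop
      simpa [ContinuousAt, Real.zero_rpow hr.ne'] using this.tendsto.mono_left nhdsWithin_le_nhds
    obtain ⟨ρ, h2, h3⟩ := ((h1.eventually_le_const (by positivity : (0 : ℝ) < τ / 2)).and
      self_mem_nhdsWithin).exists
    exact ⟨ρ, h3, h2⟩
  refine ⟨ρ, hρ0, fun μ hμ n a ha hK => ?_⟩
  have := hμ.isProbabilityMeasure
  have hlip := lipschitzWith_smoothAbs hs0
  have hmain := abs_integral_pi_sub_gaussianReal_le hr.le hlip
    (hasDerivAt_smoothAbs hs0) (hasDerivAt_deriv_smoothAbs hs0) hD0.le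
    (abs_sub_deriv_deriv_smoothAbs_le hs0 hr.le hr1) hμ hγ a 0
  have herr : ∑ k, 2 * (D * M) * |a k| ^ (2 + r) ≤ τ / 2 := by
    refine le_trans ?_ hρ
    calc _ ≤ ∑ k, 2 * (D * M) * ρ ^ r * a k ^ 2 := by
          refine Finset.sum_le_sum fun k _ => ?_
          rw [Real.rpow_add_of_nonneg (abs_nonneg _) zero_le_two hr.le, Real.rpow_two, sq_abs,
            mul_comm (a k ^ 2), ← mul_assoc]
          gcongr
          exact ha k
      _ = 2 * (D * M) * ρ ^ r * ∑ k, a k ^ 2 := by rw [Finset.mul_sum]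
      _ ≤ _ := by gcongr; exact hK.trans (le_abs_self K)
  have near {Ω : Type} [MeasurableSpace Ω] (P : Measure Ω) [IsProbabilityMeasure P] (X : Ω → ℝ)
      (hX : Integrable X P) :
      ∫ ω, |X ω| ∂P ≤ ∫ ω, smoothAbs s (X ω) ∂P ∧
        ∫ ω, smoothAbs s (X ω) ∂P ≤ ∫ ω, |X ω| ∂P + s := by
    have hi := integrable_comp_of_lipschitz hlip hX
    refine ⟨integral_mono hX.abs hi fun ω => abs_le_smoothAbs s _, ?_⟩
    refine (integral_mono hi (hX.abs.add (integrable_const s))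
      fun ω => smoothAbs_le hs0 _).trans_eq ?_
    refine (integral_add hX.abs (integrable_const s)).trans ?_
    simp
  have n1 := near _ _ (integrable_linear_pi hμ.integrable a 0)
  have n2 := near _ _ (integrable_id_gaussianReal (∑ k, ‖a k‖₊ ^ 2))
  rw [integral_abs_gaussianReal] at n2
  have hv : ((∑ k, ‖a k‖₊ ^ 2 : NNReal) : ℝ) = ∑ k, a k ^ 2 := by simp
  rw [hv] at n2
  simp only [zero_add] at n1 hmain
  rw [abs_le] at *
  constructor <;> linarith

/-! ### The noise laws -/

lemma integrable_noiseLaw_iff {p : ℝ → ℝ} (hp : Measurable p) (hp0 : ∀ x, 0 ≤ p x) (f : ℝ → ℝ) :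
    Integrable f (noiseLaw p) ↔ Integrable fun x => f x * p x := by
  rw [noiseLaw, integrable_withDensity_iff_integrable_smul' hp.ennreal_ofReal (by simp)]
  simp [ENNReal.toReal_ofReal (hp0 _), mul_comm]

lemma integral_noiseLaw {p : ℝ → ℝ} (hp : Measurable p) (hp0 : ∀ x, 0 ≤ p x) (f : ℝ → ℝ) :
    ∫ x, f x ∂(noiseLaw p) = ∫ x, f x * p x := by
  rw [noiseLaw, integral_withDensity_eq_integral_toReal_smul hp.ennreal_ofReal (by simp)]
  simp [ENNReal.toReal_ofReal (hp0 _), mul_comm]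

lemma IsNoiseDensity.isStandardized {ε L : ℝ} {p : ℝ → ℝ} (h : IsNoiseDensity ε L p) :
    IsStandardized ε L (noiseLaw p) := by
  have hi := integrable_noiseLaw_iff h.measurable h.nonneg
  have he := integral_noiseLaw h.measurable h.nonneg
  refine ⟨⟨?_⟩, (hi _).2 h.integrable_mean, (he _).trans h.mean_eq_zero,
    (hi _).2 h.integrable_sq, (he _).trans h.sq_eq_one,
    (hi _).2 h.integrable_moment, (he _).trans_le h.moment_le⟩
  rw [noiseLaw, withDensity_apply _ MeasurableSet.univ, Measure.restrict_univ,
    ← ofReal_integral_eq_lintegral_ofReal h.integrable (ae_of_all _ h.nonneg), h.integral_eq_one,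
    ENNReal.ofReal_one]

lemma noiseLaw_gaussianPDFReal : noiseLaw (gaussianPDFReal 0 1) = gaussianReal 0 1 := by
  rw [gaussianReal_of_var_ne_zero 0 one_ne_zero]
  rfl

/-! ### Regularity of the regression functions -/

lemma extend_eq_value (S : C1) (x : unitInterval) : extend S x = value S x :=
  Set.IccExtend_of_mem _ _ x.2

/-- `extend S` is constant beyond each end of `[0,1]`, that is, `extend S` composed with the
1-Lipschitz projection onto `[0,1]`; hence the Lipschitz bound holds on the whole line. -/
lemma abs_extend_sub_le {S : C1} {C : ℝ} (hS : ∀ x, |slope S x| ≤ C) (x y : ℝ) :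
    |extend S x - extend S y| ≤ C * |x - y| := by
  have hdiff : DifferentiableOn ℝ (extend S) (Icc 0 1) := S.2.differentiableOn one_ne_zero
  have hC : 0 ≤ C := (abs_nonneg _).trans (hS 0)
  have hproj (t : ℝ) : extend S t = extend S (projIcc (0 : ℝ) 1 zero_le_one t) := by
    rw [extend_eq_value]
    rfl
  rw [hproj x, hproj y]
  calc _ ≤ C * |(projIcc (0 : ℝ) 1 zero_le_one x : ℝ) - projIcc (0 : ℝ) 1 zero_le_one y| :=
        (convex_Icc (0 : ℝ) 1).norm_image_sub_le_of_norm_derivWithin_le hdiff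
          (fun t ht => hS ⟨t, ht⟩) (projIcc 0 1 zero_le_one y).2 (projIcc 0 1 zero_le_one x).2
    _ ≤ _ := mul_le_mul_of_nonneg_left (abs_projIcc_sub_projIcc (zero_le_one' ℝ)) hC

/-! ### Riemann sums over a window -/

lemma weight_eq_ite {β : ℝ} {n : ℕ} (hh : 0 < bandwidth β n) (z₀ : unitInterval) (k : Fin n) :
    weight β z₀ n k = if (z₀ : ℝ) - bandwidth β n ≤ design n k ∧
      (design n k : ℝ) ≤ z₀ + bandwidth β n then 1 else 0 := by
  rw [weight, kernel, Set.indicator_apply]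
  refine if_congr ?_ rfl rfl
  rw [mem_Icc, le_div_iff₀ hh, div_le_iff₀ hh]
  constructor <;> rintro ⟨h1, h2⟩ <;> constructor <;> linarith

lemma weight_mul_self (β : ℝ) (z₀ : unitInterval) (n : ℕ) (k : Fin n) :
    weight β z₀ n k * weight β z₀ n k = weight β z₀ n k := by
  rw [weight, kernel, Set.indicator_apply]
  split_ifs <;> simp

lemma weight_nonneg (β : ℝ) (z₀ : unitInterval) (n : ℕ) (k : Fin n) : 0 ≤ weight β z₀ n k := by
  rw [weight, kernel, Set.indicator_apply]
  split_ifs <;> simp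

lemma weight_le_one (β : ℝ) (z₀ : unitInterval) (n : ℕ) (k : Fin n) : weight β z₀ n k ≤ 1 := by
  rw [weight, kernel, Set.indicator_apply]
  split_ifs <;> simp

/-- The window of the kernel, as an interval of indices. -/
lemma exists_sum_weight_eq {β : ℝ} {n : ℕ} {z₀ : unitInterval} (hn : 0 < n)
    (hh : 0 < bandwidth β n) (h0 : 0 < z₀ - bandwidth β n) (h1 : z₀ + bandwidth β n ≤ 1)
    (hnh : 1 ≤ n * bandwidth β n) :
    ∃ A B : ℕ, A ≤ B ∧ (A : ℝ) ≤ n * (z₀ - bandwidth β n) ∧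
      (n * (z₀ - bandwidth β n) : ℝ) ≤ A + 1 ∧ (B : ℝ) ≤ n * (z₀ + bandwidth β n) ∧
      (n * (z₀ + bandwidth β n) : ℝ) ≤ B + 1 ∧
      ∀ F : ℝ → ℝ, ∑ k, weight β z₀ n k * F (design n k)
        = ∑ j ∈ Finset.Ico A B, F (((j : ℝ) + 1) / n) := by
  set h := bandwidth β n
  have hn' : (0 : ℝ) < n := by exact_mod_cast hn
  set u : ℝ := n * (z₀ - h) with hu
  set v : ℝ := n * (z₀ + h) with hv
  have hu0 : 0 < u := by positivity
  have huv : u + 2 ≤ v := by rw [hu, hv]; nlinarith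
  have hv0 : 0 ≤ v := by linarith
  have hvn : v ≤ n := by rw [hv]; nlinarith
  have hc : 1 ≤ ⌈u⌉₊ := Nat.one_le_ceil_iff.2 hu0
  have hcast : ((⌈u⌉₊ - 1 : ℕ) : ℝ) = ⌈u⌉₊ - 1 := by push_cast [hc]; ring
  have hc1 := Nat.ceil_lt_add_one hu0.le
  have hc2 := Nat.le_ceil u
  have hf1 := Nat.floor_le hv0
  have hf2 := Nat.lt_floor_add_one v
  have hBn : ⌊v⌋₊ ≤ n := Nat.floor_le_of_le hvn
  -- Index `j` stands for the design point `(j + 1) / n`, so `u ≤ j + 1 ≤ v` means `⌈u⌉₊ - 1 ≤ j <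
  -- ⌊v⌋₊`. The subtraction is not truncated, as `u > 0`.
  refine ⟨⌈u⌉₊ - 1, ⌊v⌋₊, ?_, by linarith, by linarith, hf1, hf2.le, fun F => ?_⟩
  · have : ((⌈u⌉₊ - 1 : ℕ) : ℝ) ≤ ⌊v⌋₊ := by linarith
    exact_mod_cast this
  · have hterm (k : Fin n) : weight β z₀ n k * F (design n k)
        = (fun j : ℕ => if ⌈u⌉₊ - 1 ≤ j ∧ j < ⌊v⌋₊ then F (((j : ℝ) + 1) / n) else 0) k := by
      rw [weight_eq_ite hh, ite_mul, one_mul, zero_mul]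
      refine if_congr (and_congr ?_ ?_) rfl rfl
      · change _ ≤ ((k : ℕ) + 1 : ℝ) / n ↔ _
        rw [le_div_iff₀ hn', mul_comm, Nat.sub_le_iff_le_add, Nat.ceil_le]
        push_cast
        rfl
      · change ((k : ℕ) + 1 : ℝ) / n ≤ _ ↔ _
        rw [div_le_iff₀ hn', mul_comm (_ + _) (n : ℝ), ← Nat.succ_le_iff, Nat.le_floor_iff hv0]
        push_cast
        rfl
    rw [Finset.sum_congr rfl fun k _ => hterm k, Fin.sum_univ_eq_sum_range
      (fun j : ℕ => if ⌈u⌉₊ - 1 ≤ j ∧ j < ⌊v⌋₊ then F (((j : ℝ) + 1) / n) else 0),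
      ← Finset.sum_filter]
    refine Finset.sum_congr ?_ fun _ _ => rfl
    ext j
    simp only [Finset.mem_filter, Finset.mem_range, Finset.mem_Ico]
    omega

lemma abs_totalWeight_sub_le {β : ℝ} {n : ℕ} {z₀ : unitInterval} (hn : 0 < n)
    (hh : 0 < bandwidth β n) (h0 : 0 < z₀ - bandwidth β n) (h1 : z₀ + bandwidth β n ≤ 1)
    (hnh : 1 ≤ n * bandwidth β n) :
    |totalWeight β z₀ n - 2 * (n * bandwidth β n)| ≤ 1 := by
  obtain ⟨A, B, hAB, hA1, hA2, hB1, hB2, hF⟩ := exists_sum_weight_eq hn hh h0 h1 hnh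
  have : totalWeight β z₀ n = B - A := by
    have := hF fun _ => 1
    simp only [mul_one, Finset.sum_const, Nat.card_Ico, nsmul_eq_mul] at this
    rw [totalWeight, this, Nat.cast_sub hAB]
  rw [this, abs_le]
  constructor <;> linarith

/-- The constant is `7 = 3 + 2 + 2`: there are at most `2nh + 1 ≤ 3nh` cells, each with error `C /
n`, and two end pieces of length at most `1 / n`, on which `|F| ≤ 2Ch` because `F` vanishes at `z₀`.
-/
lemma abs_sum_weight_sub_integral_le {β : ℝ} {n : ℕ} {z₀ : unitInterval} (hn : 0 < n)
    (hh : 0 < bandwidth β n) (h0 : 0 < z₀ - bandwidth β n) (h1 : z₀ + bandwidth β n ≤ 1)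
    (hnh : 1 ≤ n * bandwidth β n) {F : ℝ → ℝ} {C : ℝ} (hF : ∀ x y, |F x - F y| ≤ C * |x - y|)
    (hFz : F z₀ = 0) :
    |∑ k, weight β z₀ n k * F (design n k)
      - n * ∫ x in (z₀ - bandwidth β n : ℝ)..(z₀ + bandwidth β n), F x|
      ≤ 7 * C * bandwidth β n := by
  obtain ⟨A, B, hAB, hA1, hA2, hB1, hB2, hsum⟩ := exists_sum_weight_eq hn hh h0 h1 hnh
  set h := bandwidth β n
  have hn' : (0 : ℝ) < n := by exact_mod_cast hn
  have hC : 0 ≤ C := by simpa using (abs_nonneg _).trans (hF 1 0)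
  have hcont : Continuous F := by
    refine (LipschitzWith.of_dist_le_mul (K := ⟨C, hC⟩) fun x y => ?_).continuous
    rw [Real.dist_eq, Real.dist_eq]
    exact hF x y
  have hint (a b : ℝ) : IntervalIntegrable F volume a b := hcont.intervalIntegrable a b
  have hinv : 1 / (n : ℝ) ≤ h := by rw [div_le_iff₀ hn']; linarith
  have hcells : |∑ j ∈ Finset.Ico A B, F (((j : ℝ) + 1) / n)
      - n * ∫ x in ((A : ℝ) / n)..(B / n), F x| ≤ (B - A) * (C / n) := by
    have hadj := intervalIntegral.sum_integral_adjacent_intervals_Ico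
      (f := F) (μ := volume) (a := fun j : ℕ => (j : ℝ) / n) hAB fun _ _ => hint _ _
    rw [← hadj, Finset.mul_sum, ← Finset.sum_sub_distrib]
    refine (Finset.abs_sum_le_sum_abs _ _).trans ?_
    have hcell (j : ℕ) : |F (((j : ℝ) + 1) / n)
        - n * ∫ x in ((j : ℝ) / n)..((j + 1 : ℕ) / n), F x| ≤ C / n := by
      have hlen : ((j + 1 : ℕ) / n : ℝ) - j / n = 1 / n := by push_cast; ring
      have hle : (j : ℝ) / n ≤ (j + 1 : ℕ) / n := by push_cast; gcongr; linarith
      have e : F (((j : ℝ) + 1) / n) - n * ∫ x in ((j : ℝ) / n)..((j + 1 : ℕ) / n), F x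
          = n * ∫ x in ((j : ℝ) / n)..((j + 1 : ℕ) / n), (F ((j + 1 : ℕ) / n) - F x) := by
        rw [intervalIntegral.integral_sub (by simp) (hint _ _), intervalIntegral.integral_const,
          hlen, mul_sub, smul_eq_mul, ← mul_assoc, mul_one_div_cancel hn'.ne', one_mul]
        push_cast
        rfl
      rw [e, abs_mul, abs_of_pos hn']
      have := intervalIntegral.norm_integral_le_of_norm_le_const
        (a := (j : ℝ) / n) (b := (j + 1 : ℕ) / n) (f := fun x => F ((j + 1 : ℕ) / n) - F x)
        (C := C * (1 / n)) fun x hx => by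
          rw [uIoc_of_le hle] at hx
          refine (hF _ _).trans ?_
          rw [abs_of_nonneg (by linarith [hx.2])]
          gcongr
          linarith [hx.1]
      rw [hlen, abs_of_pos (by positivity), Real.norm_eq_abs] at this
      calc _ ≤ n * (C * (1 / n) * (1 / n)) := by gcongr
        _ = C / n := by field_simp
    refine (Finset.sum_le_sum fun j _ => hcell j).trans_eq ?_
    rw [Finset.sum_const, Nat.card_Ico, nsmul_eq_mul, Nat.cast_sub hAB]
  have hend (c e : ℝ) (hce : c ≤ e) (hec : e ≤ c + 1 / n) (hc : z₀ - 2 * h ≤ c)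
      (he : e ≤ z₀ + 2 * h) : |∫ x in c..e, F x| ≤ 2 * C * h * (1 / n) := by
    have := intervalIntegral.norm_integral_le_of_norm_le_const
      (a := c) (b := e) (f := F) (C := C * (2 * h)) fun x hx => by
        rw [uIoc_of_le hce] at hx
        have h3 := hF x z₀
        rw [hFz, sub_zero] at h3
        refine h3.trans ?_
        gcongr
        rw [abs_le]
        constructor <;> linarith [hx.1, hx.2]
    rw [abs_of_nonneg (sub_nonneg.2 hce)] at this
    refine this.trans ?_
    calc _ ≤ C * (2 * h) * (1 / n) := by gcongr; linarith
      _ = _ := by ring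
  have d1 (x y : ℝ) (hxy : x ≤ n * y) : x / n ≤ y := by rw [div_le_iff₀ hn']; linarith
  have d2 (x y : ℝ) (hxy : n * y ≤ x + 1) : y ≤ x / n + 1 / n := by
    rw [← add_div, le_div_iff₀ hn']; linarith
  have hlow := hend (A / n) (z₀ - h) (d1 _ _ hA1) (d2 _ _ hA2) (by linarith [d2 _ _ hA2])
    (by linarith)
  have hupp := hend (B / n) (z₀ + h) (d1 _ _ hB1) (d2 _ _ hB2) (by linarith [d2 _ _ hB2])
    (by linarith)
  have hsplit : ∫ x in (z₀ - h : ℝ)..(z₀ + h), F x = (∫ x in ((A : ℝ) / n)..(B / n), F x)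
      + (∫ x in ((B : ℝ) / n)..(z₀ + h), F x) - ∫ x in ((A : ℝ) / n)..(z₀ - h), F x := by
    rw [intervalIntegral.integral_add_adjacent_intervals (hint _ _) (hint _ _),
      intervalIntegral.integral_interval_sub_left (hint _ _) (hint _ _)]
  have hBA : ((B : ℝ) - A) * (C / n) ≤ 3 * C * h := by
    have : (B : ℝ) - A ≤ 3 * (n * h) := by linarith
    calc _ ≤ 3 * (n * h) * (C / n) := by gcongr
      _ = _ := by field_simp
  have m (x : ℝ) (hx : |x| ≤ 2 * C * h * (1 / n)) : |n * x| ≤ 2 * C * h := by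
    rw [abs_mul, abs_of_pos hn']
    calc _ ≤ n * (2 * C * h * (1 / n)) := by gcongr
      _ = _ := by field_simp
  have m1 := m _ hlow
  have m2 := m _ hupp
  rw [hsum, hsplit, mul_sub, mul_add]
  rw [abs_le] at hcells m1 m2 ⊢
  constructor <;> linarith

lemma abs_sum_weight_value_sub_le {β : ℝ} {n : ℕ} {z₀ : unitInterval} (hn : 0 < n)
    (hh : 0 < bandwidth β n) (h0 : 0 < z₀ - bandwidth β n) (h1 : z₀ + bandwidth β n ≤ 1)
    (hnh : 1 ≤ n * bandwidth β n) {δ : ℝ} {S : C1} (hS : S ∈ weakHolder β z₀ δ) :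
    |∑ k, weight β z₀ n k * (value S (design n k) - value S z₀)|
      ≤ 7 * δ⁻¹ * bandwidth β n + δ * (n * bandwidth β n) * bandwidth β n ^ β := by
  obtain ⟨-, hslope, hbias⟩ := hS
  set h := bandwidth β n
  have hn' : (0 : ℝ) < n := by exact_mod_cast hn
  have hR := abs_sum_weight_sub_integral_le hn hh h0 h1 hnh
    (F := fun x => extend S x - value S z₀) (C := δ⁻¹)
    (fun x y => by simpa using abs_extend_sub_le hslope x y) (by simp [extend_eq_value])
  simp only [extend_eq_value] at hR
  have hI : ∫ x in (z₀ - h : ℝ)..(z₀ + h), (extend S x - value S z₀)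
      = h * ∫ u in (-1 : ℝ)..1, (extend S (z₀ + h * u) - value S z₀) := by
    have := intervalIntegral.mul_integral_comp_add_mul
      (f := fun x => extend S x - value S z₀) (a := -1) (b := 1) h (z₀ : ℝ)
    rw [this]
    congr 1 <;> ring
  have hb := hbias h hh h0.le h1
  have hb' : |n * (h * ∫ u in (-1 : ℝ)..1, (extend S (z₀ + h * u) - value S z₀))|
      ≤ δ * (n * h) * h ^ β := by
    rw [abs_mul, abs_mul, abs_of_pos hn', abs_of_pos hh]
    calc _ ≤ n * (h * (δ * h ^ β)) := by gcongr
      _ = _ := by ring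
  rw [hI] at hR
  rw [abs_le] at hR hb' ⊢
  constructor <;> linarith

/-! ### Asymptotics of the normalizations -/

section Asymptotics

variable {β : ℝ}

lemma bandwidth_pos (β : ℝ) {n : ℕ} (hn : 0 < n) : 0 < bandwidth β n :=
  Real.rpow_pos_of_pos (by exact_mod_cast hn) _

lemma rate_pos (β : ℝ) {n : ℕ} (hn : 0 < n) : 0 < rate β n :=
  Real.rpow_pos_of_pos (by exact_mod_cast hn) _

/-- With `rate_mul_bandwidth_rpow` this expresses the bias-variance balance: `φ_n` is both `√(nh)`
and `h^(-β)`. -/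
lemma rate_sq (hβ : 0 < β) {n : ℕ} (hn : 0 < n) : rate β n ^ 2 = n * bandwidth β n := by
  have hn' : (0 : ℝ) < n := by exact_mod_cast hn
  rw [rate, bandwidth, ← Real.rpow_natCast, ← Real.rpow_mul hn'.le]
  nth_rw 2 [← Real.rpow_one (n : ℝ)]
  rw [← Real.rpow_add hn']
  congr 1
  have : 2 * β + 1 ≠ 0 := by positivity
  field_simp
  push_cast
  ring

lemma rate_mul_bandwidth_rpow (β : ℝ) {n : ℕ} (hn : 0 < n) :
    rate β n * bandwidth β n ^ β = 1 := by
  have hn' : (0 : ℝ) < n := by exact_mod_cast hn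
  rw [rate, bandwidth, ← Real.rpow_mul hn'.le, ← Real.rpow_add hn']
  convert Real.rpow_zero (n : ℝ) using 2
  ring

lemma tendsto_rate (hβ : 0 < β) : Tendsto (rate β) atTop atTop :=
  (tendsto_rpow_atTop (by positivity : 0 < β / (2 * β + 1))).comp tendsto_natCast_atTop_atTop

lemma tendsto_bandwidth (hβ : 0 < β) : Tendsto (bandwidth β) atTop (𝓝 0) := by
  have := (tendsto_rpow_neg_atTop (by positivity : 0 < 1 / (2 * β + 1))).comp
    tendsto_natCast_atTop_atTop
  refine this.congr fun n => ?_
  simp only [bandwidth, Function.comp_apply, neg_div]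

lemma eventually_window (hβ : 0 < β) {z₀ : unitInterval} (hz₀ : 0 < z₀) (hz₁ : z₀ < 1) :
    ∀ᶠ n : ℕ in atTop, 0 < n ∧ 0 < bandwidth β n ∧ 0 < z₀ - bandwidth β n ∧
      z₀ + bandwidth β n ≤ 1 ∧ 1 ≤ n * bandwidth β n := by
  have h0 : (0 : ℝ) < z₀ := hz₀
  have h1 : (0 : ℝ) < 1 - z₀ := sub_pos.2 hz₁
  filter_upwards [eventually_gt_atTop 0, (tendsto_bandwidth hβ).eventually_lt_const h0,
    (tendsto_bandwidth hβ).eventually_lt_const h1, (tendsto_rate hβ).eventually_ge_atTop 1]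
    with n hn h2 h3 h4
  refine ⟨hn, bandwidth_pos β hn, by linarith, by linarith, ?_⟩
  rw [← rate_sq hβ hn]
  exact one_le_pow₀ h4

/-- The window holds `2nh + O(1)` design points and `φ_n² = nh`. This limit is the source of the
factor `1 / √2`. -/
lemma tendsto_rate_sq_div (hβ : 0 < β) {z₀ : unitInterval} (hz₀ : 0 < z₀) (hz₁ : z₀ < 1) :
    Tendsto (fun n => rate β n ^ 2 / totalWeight β z₀ n) atTop (𝓝 (1 / 2)) := by
  have hr : Tendsto (fun n => (rate β n ^ 2)⁻¹) atTop (𝓝 0) :=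
    ((tendsto_pow_atTop two_ne_zero).comp (tendsto_rate hβ)).inv_tendsto_atTop
  have : Tendsto (fun n => totalWeight β z₀ n / rate β n ^ 2) atTop (𝓝 2) := by
    rw [tendsto_iff_norm_sub_tendsto_zero]
    refine squeeze_zero' (Eventually.of_forall fun n => norm_nonneg _) ?_ hr
    filter_upwards [eventually_window hβ hz₀ hz₁] with n ⟨hn, h2, h3, h4, h5⟩
    have h := abs_totalWeight_sub_le hn h2 h3 h4 h5
    rw [← rate_sq hβ hn] at h
    have hp := pow_pos (rate_pos β hn) 2
    rw [show totalWeight β z₀ n / rate β n ^ 2 - 2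
      = (totalWeight β z₀ n - 2 * rate β n ^ 2) / rate β n ^ 2 by
        rw [sub_div, mul_div_cancel_right₀ _ hp.ne'], Real.norm_eq_abs,
      abs_div, abs_of_pos hp, div_le_iff₀ hp, inv_mul_cancel₀ hp.ne']
    exact h
  simpa using this.inv₀ two_ne_zero

lemma tendsto_rate_div (hβ : 0 < β) {z₀ : unitInterval} (hz₀ : 0 < z₀) (hz₁ : z₀ < 1) :
    Tendsto (fun n => rate β n / totalWeight β z₀ n) atTop (𝓝 0) := by
  have h := (tendsto_rate_sq_div hβ hz₀ hz₁).mul (tendsto_rate hβ).inv_tendsto_atTop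
  rw [mul_zero] at h
  refine h.congr' ?_
  filter_upwards [eventually_gt_atTop 0] with n hn
  have := (rate_pos β hn).ne'
  simp only [Pi.inv_apply]
  field_simp

lemma totalWeight_pos {n : ℕ} {z₀ : unitInterval} (hn : 0 < n)
    (hh : 0 < bandwidth β n) (h0 : 0 < z₀ - bandwidth β n) (h1 : z₀ + bandwidth β n ≤ 1)
    (hnh : 1 ≤ n * bandwidth β n) : 0 < totalWeight β z₀ n := by
  have := (abs_le.1 (abs_totalWeight_sub_le hn hh h0 h1 hnh)).1
  linarith

end Asymptotics

/-! ### The normalized error of the kernel estimator -/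

/-- The normalized bias of the kernel estimator. -/
def normalizedBias (β : ℝ) (z₀ : unitInterval) (g : unitInterval → C1 → ℝ) (n : ℕ) (S : C1) : ℝ :=
  rate β n / totalWeight β z₀ n / g z₀ S *
    ∑ k, weight β z₀ n k * (value S (design n k) - value S z₀)

/-- The coefficient of the `k`-th noise variable in the normalized error of the kernel
estimator. -/
def noiseCoeff (β : ℝ) (z₀ : unitInterval) (g : unitInterval → C1 → ℝ) (n : ℕ) (S : C1)
    (k : Fin n) : ℝ :=
  rate β n / totalWeight β z₀ n * (weight β z₀ n k * g (design n k) S / g z₀ S)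

variable {β : ℝ} {z₀ : unitInterval} {g : unitInterval → C1 → ℝ}

lemma kernelEstimator_error {n : ℕ} (hr : 0 ≤ rate β n) (hq : 0 < totalWeight β z₀ n) {S : C1}
    (hg : 0 < g z₀ S) (ξ : Fin n → ℝ) :
    rate β n * (|kernelEstimator β z₀ n
      (fun k => value S (design n k) + g (design n k) S * ξ k) - value S z₀| / g z₀ S)
      = |normalizedBias β z₀ g n S + ∑ k, noiseCoeff β z₀ g n S k * ξ k| := by
  have hq' := hq.ne'
  have e : normalizedBias β z₀ g n S + ∑ k, noiseCoeff β z₀ g n S k * ξ k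
      = rate β n * ((kernelEstimator β z₀ n
        (fun k => value S (design n k) + g (design n k) S * ξ k) - value S z₀) / g z₀ S) := by
    have h1 : ∑ k, weight β z₀ n k * (value S (design n k) - value S z₀)
        = ∑ k, weight β z₀ n k * value S (design n k) - totalWeight β z₀ n * value S z₀ := by
      simp only [mul_sub, Finset.sum_sub_distrib, totalWeight, Finset.sum_mul]
    have h2 : ∑ k, noiseCoeff β z₀ g n S k * ξ k = rate β n / totalWeight β z₀ n / g z₀ S *
        ∑ k, weight β z₀ n k * (g (design n k) S * ξ k) := by
      rw [Finset.mul_sum]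
      refine Finset.sum_congr rfl fun k _ => ?_
      rw [noiseCoeff]
      ring
    rw [normalizedBias, h1, h2, kernelEstimator]
    simp only [mul_add, Finset.sum_add_distrib]
    field_simp
    ring
  rw [e, abs_mul, abs_div, abs_of_nonneg hr, abs_of_pos hg]

lemma lintegral_obsLaw_eq {n : ℕ} (hr : 0 ≤ rate β n) (hq : 0 < totalWeight β z₀ n) {S : C1}
    (hg : 0 < g z₀ S) {ε L : ℝ} {p : ℝ → ℝ} (hp : IsNoiseDensity ε L p) :
    ∫⁻ y, ENNReal.ofReal (rate β n * (|kernelEstimator β z₀ n y - value S z₀| / g z₀ S))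
        ∂(obsLaw g p S n)
      = ENNReal.ofReal (∫ ξ, |normalizedBias β z₀ g n S + ∑ k, noiseCoeff β z₀ g n S k * ξ k|
          ∂(Measure.pi fun _ => noiseLaw p)) := by
  have hs := hp.isStandardized
  have := hs.isProbabilityMeasure
  rw [obsLaw, lintegral_map (by unfold kernelEstimator; fun_prop) (by fun_prop),
    ofReal_integral_eq_lintegral_ofReal (integrable_linear_pi hs.integrable _ _).abs
      (ae_of_all _ fun _ => abs_nonneg _)]
  simp only [kernelEstimator_error hr hq hg]

lemma eventually_normalizedBias_le (hβ : 0 < β) (hz₀ : 0 < z₀) (hz₁ : z₀ < 1) {c : ℝ} (hc : 0 < c)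
    (hg : ∀ x S, c ≤ g x S) {δ : ℝ} (hδ : 0 < δ) {τ : ℝ} (hτ : 0 < τ) :
    ∀ᶠ n in atTop, ∀ S ∈ weakHolder β z₀ δ, |normalizedBias β z₀ g n S| ≤ δ / c + τ := by
  have h1 : Tendsto (fun n => rate β n / totalWeight β z₀ n * (7 * δ⁻¹ * bandwidth β n) / c)
      atTop (𝓝 0) := by
    simpa using ((tendsto_rate_div hβ hz₀ hz₁).mul
      ((tendsto_bandwidth hβ).const_mul (7 * δ⁻¹))).div_const c
  filter_upwards [eventually_window hβ hz₀ hz₁, h1.eventually_le_const hτ,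
    -- Any number above the limit `1/2` would do; `1` gives the clean bound `δ / c`.
    (tendsto_rate_sq_div hβ hz₀ hz₁).eventually_le_const (by norm_num : (1 / 2 : ℝ) < 1)]
    with n ⟨hn, w1, w2, w3, w4⟩ h2 h3 S hS
  have hb := abs_sum_weight_value_sub_le hn w1 w2 w3 w4 hS
  have hq := totalWeight_pos hn w1 w2 w3 w4
  have hr := rate_pos β hn
  have hgS := hg z₀ S
  have hgS0 := hc.trans_le hgS
  rw [normalizedBias, abs_mul, abs_of_pos (by positivity)]
  rw [← rate_sq hβ hn] at hb
  have hrb := rate_mul_bandwidth_rpow β hn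
  calc _ ≤ rate β n / totalWeight β z₀ n / c *
        (7 * δ⁻¹ * bandwidth β n + δ * rate β n ^ 2 * bandwidth β n ^ β) := by gcongr
    _ = rate β n / totalWeight β z₀ n * (7 * δ⁻¹ * bandwidth β n) / c
        + rate β n ^ 2 / totalWeight β z₀ n * δ * (rate β n * bandwidth β n ^ β) / c := by ring
    _ ≤ τ + 1 * δ * 1 / c := by rw [hrb]; gcongr
    _ = _ := by ring

/-- The weights are `0` or `1`, hence equal to their squares; this makes the local average of `g²`
appear. -/
lemma sum_noiseCoeff_sq (n : ℕ) (S : C1) :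
    ∑ k, noiseCoeff β z₀ g n S k ^ 2 = rate β n ^ 2 / totalWeight β z₀ n *
      ((1 / totalWeight β z₀ n * ∑ k, weight β z₀ n k * g (design n k) S ^ 2) / g z₀ S ^ 2) := by
  simp only [Finset.mul_sum, Finset.sum_div]
  refine Finset.sum_congr rfl fun k _ => ?_
  calc _ = rate β n ^ 2 / totalWeight β z₀ n * (1 / totalWeight β z₀ n *
        (weight β z₀ n k * weight β z₀ n k * g (design n k) S ^ 2) / g z₀ S ^ 2) := by
        rw [noiseCoeff]
        ring
    _ = _ := by rw [weight_mul_self]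

lemma eventually_sqrt_sum_noiseCoeff_sq (hβ : 0 < β) (hz₀ : 0 < z₀) (hz₁ : z₀ < 1)
    (hg : IsScale β z₀ g) {δ : ℝ} (hδ : 0 < δ) (hδ1 : δ < 1) {τ : ℝ} (hτ : 0 < τ) :
    ∀ᶠ n in atTop, ∀ S ∈ weakHolder β z₀ δ,
      |√(∑ k, noiseCoeff β z₀ g n S k ^ 2) - 1 / √2| ≤ τ := by
  obtain ⟨c, C, hc, hgc⟩ := hg.bounds
  have h1 : Tendsto (fun n => √(rate β n ^ 2 / totalWeight β z₀ n)) atTop (𝓝 (1 / √2)) := by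
    simpa using (tendsto_rate_sq_div hβ hz₀ hz₁).sqrt
  -- The tolerance carries a factor `c` because the error is later divided by `g z₀ S ≥ c`.
  filter_upwards [Metric.tendstoUniformlyOn_iff.1 (hg.average δ hδ hδ1) (c * (τ / 2))
      (by positivity), Metric.tendsto_nhds.1 h1 (τ / 2) (by positivity),
      (tendsto_rate_sq_div hβ hz₀ hz₁).eventually_le_const (by norm_num : (1 / 2 : ℝ) < 1),
      eventually_window hβ hz₀ hz₁] with n h2 h3 h4 ⟨hn, w1, w2, w3, w4⟩ S hS
  have hgS := (hgc z₀ S).1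
  have hgS0 := hc.trans_le hgS
  have hq := totalWeight_pos hn w1 w2 w3 w4
  have h5 := h2 S hS
  rw [sum_noiseCoeff_sq, Real.sqrt_mul (by positivity), Real.sqrt_div' _ (sq_nonneg (g z₀ S)),
    Real.sqrt_sq hgS0.le]
  set G := √(1 / totalWeight β z₀ n * ∑ k, weight β z₀ n k * g (design n k) S ^ 2)
  set a := √(rate β n ^ 2 / totalWeight β z₀ n)
  have ha0 : 0 ≤ a := Real.sqrt_nonneg _
  have ha1 : a ≤ 1 := Real.sqrt_le_one.2 h4
  rw [Real.dist_eq] at h3 h5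
  have h6 : |G / g z₀ S - 1| ≤ τ / 2 := by
    rw [show G / g z₀ S - 1 = (G - g z₀ S) / g z₀ S by field_simp, abs_div, abs_of_pos hgS0,
      div_le_iff₀ hgS0, abs_sub_comm]
    calc _ ≤ c * (τ / 2) := h5.le
      _ ≤ g z₀ S * (τ / 2) := by gcongr
      _ = _ := mul_comm _ _
  calc _ = |a * (G / g z₀ S - 1) + (a - 1 / √2)| := by congr 1; ring
    _ ≤ |a * (G / g z₀ S - 1)| + |a - 1 / √2| := abs_add_le _ _
    _ ≤ 1 * (τ / 2) + τ / 2 := by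
      rw [abs_mul, abs_of_nonneg ha0]
      gcongr
    _ = τ := by ring

/-- Lindeberg's negligibility condition: each coefficient is at most `(φ_n / q_n) C / c`, which
tends to zero. -/
lemma eventually_noiseCoeff_le (hβ : 0 < β) (hz₀ : 0 < z₀) (hz₁ : z₀ < 1)
    (hg : IsScale β z₀ g) {ρ : ℝ} (hρ : 0 < ρ) :
    ∀ᶠ n in atTop, ∀ S k, |noiseCoeff β z₀ g n S k| ≤ ρ := by
  obtain ⟨c, C, hc, hgc⟩ := hg.bounds
  have h1 : Tendsto (fun n => rate β n / totalWeight β z₀ n * (1 * C / c)) atTop (𝓝 0) := by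
    simpa using (tendsto_rate_div hβ hz₀ hz₁).mul_const (1 * C / c)
  filter_upwards [h1.eventually_le_const hρ, eventually_window hβ hz₀ hz₁]
    with n h2 ⟨hn, w1, w2, w3, w4⟩ S k
  have hq := totalWeight_pos hn w1 w2 w3 w4
  have hr := rate_pos β hn
  have h3 := hgc z₀ S
  have h4 := hgc (design n k) S
  have h5 := weight_nonneg β z₀ n k
  have h6 := weight_le_one β z₀ n k
  have h7 : 0 < g z₀ S := hc.trans_le h3.1
  have h8 : 0 < g (design n k) S := hc.trans_le h4.1
  rw [noiseCoeff, abs_of_nonneg (by positivity)]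
  have h9 : 0 < C := h8.trans_le h4.2
  refine le_trans ?_ h2
  gcongr
  · exact h4.2
  · exact h3.1

/-- The normalized stochastic error is asymptotically Gaussian in mean absolute value, uniformly
over the regression functions and the noise laws. -/
lemma eventually_abs_integral_noise_sub_le (hβ : 0 < β) (hz₀ : 0 < z₀) (hz₁ : z₀ < 1)
    (hg : IsScale β z₀ g) {ε L : ℝ} (hε : 0 < ε)
    (hL : IsNoiseDensity ε L (gaussianPDFReal 0 1)) {δ : ℝ} (hδ : 0 < δ) (hδ1 : δ < 1)
    {τ : ℝ} (hτ : 0 < τ) :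
    ∀ᶠ n in atTop, ∀ S ∈ weakHolder β z₀ δ, ∀ p, IsNoiseDensity ε L p →
      |∫ ξ, |∑ k, noiseCoeff β z₀ g n S k * ξ k| ∂(Measure.pi fun _ => noiseLaw p)
        - gaussianAbsMoment / √2| ≤ τ := by
  have hγ := hL.isStandardized
  rw [noiseLaw_gaussianPDFReal] at hγ
  -- The variance bound `4` comes from `√V ≤ 1 / √2 + 1 ≤ 2`, guaranteed by the `1` in the minimum
  -- below.
  obtain ⟨ρ, hρ0, hρ⟩ := abs_integral_abs_sub_le hε hγ 4 (half_pos hτ)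
  have hm := gaussianAbsMoment_nonneg
  have hσ : 0 < min 1 (τ / 2 / (gaussianAbsMoment + 1)) := by positivity
  filter_upwards [eventually_noiseCoeff_le hβ hz₀ hz₁ hg hρ0,
    eventually_sqrt_sum_noiseCoeff_sq hβ hz₀ hz₁ hg hδ hδ1 hσ] with n h1 h2 S hS p hp
  have h3 := h2 S hS
  set V := ∑ k, noiseCoeff β z₀ g n S k ^ 2 with hV
  have hV0 : 0 ≤ V := Finset.sum_nonneg fun k _ => sq_nonneg _
  have h4 : |√V - 1 / √2| ≤ 1 := h3.trans (min_le_left _ _)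
  have h5 : |√V - 1 / √2| ≤ τ / 2 / (gaussianAbsMoment + 1) := h3.trans (min_le_right _ _)
  have h6 : 1 / √2 ≤ 1 := by
    rw [div_le_one (by positivity)]
    exact Real.one_le_sqrt.2 one_le_two
  have h7 : V ≤ 4 := by
    have : √V ≤ 2 := by linarith [(abs_le.1 h4).2]
    rw [Real.sqrt_le_left zero_le_two] at this
    linarith
  have h8 := hρ _ hp.isStandardized n _ (h1 S) h7
  rw [← hV] at h8
  have h9 : |√V * gaussianAbsMoment - gaussianAbsMoment / √2| ≤ τ / 2 := by
    rw [show √V * gaussianAbsMoment - gaussianAbsMoment / √2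
      = (√V - 1 / √2) * gaussianAbsMoment by ring, abs_mul, abs_of_nonneg hm]
    rw [le_div_iff₀ (by positivity)] at h5
    nlinarith [abs_nonneg (√V - 1 / √2)]
  calc _ ≤ _ := abs_sub_le _ (√V * gaussianAbsMoment) _
    _ ≤ τ / 2 + τ / 2 := add_le_add h8 h9
    _ = τ := by ring

/-! ### The risk of the kernel estimator -/

lemma zero_mem_weakHolder (β : ℝ) (z₀ : unitInterval) {δ : ℝ} (hδ : 0 < δ) :
    (0 : C1) ∈ weakHolder β z₀ δ := by
  have hext : extend 0 = fun _ => (0 : ℝ) := rfl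
  have hslope (x : unitInterval) : slope 0 x = 0 := by simp [slope, hext]
  have hval : value 0 z₀ = 0 := rfl
  refine ⟨?_, fun x => by rw [hslope]; simpa using hδ.le, fun h hh _ _ => ?_⟩
  · simp only [holderClass, mem_iUnion]
    refine ⟨1, one_pos, 1, one_pos, fun x => by simp [hslope], fun x y => ?_⟩
    simp only [hslope, sub_self, abs_zero]
    positivity
  · simp only [hext, hval, sub_self, intervalIntegral.integral_zero, abs_zero]
    positivity

/-- The tolerances for the bias and for the noise are both taken equal to `δ`, whence `δ / c + 2 *
δ`, which vanishes with `δ`. -/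
lemma eventually_risk_le (hβ : 0 < β) (hz₀ : 0 < z₀) (hz₁ : z₀ < 1) (hg : IsScale β z₀ g)
    {c : ℝ} (hc : 0 < c) (hgc : ∀ x S, c ≤ g x S) {ε L : ℝ} (hε : 0 < ε)
    (hL : IsNoiseDensity ε L (gaussianPDFReal 0 1)) {δ : ℝ} (hδ : 0 < δ) (hδ1 : δ < 1) :
    ∀ᶠ n in atTop, risk β z₀ g ε L δ n (kernelEstimator β z₀ n)
      ≤ ENNReal.ofReal (gaussianAbsMoment / √2 + (δ / c + 2 * δ)) := by
  filter_upwards [eventually_window hβ hz₀ hz₁,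
    eventually_normalizedBias_le hβ hz₀ hz₁ hc hgc hδ hδ,
    eventually_abs_integral_noise_sub_le hβ hz₀ hz₁ hg hε hL hδ hδ1 hδ]
    with n ⟨hn, w1, w2, w3, w4⟩ hbias hnoise
  refine iSup₂_le fun p hp => iSup₂_le fun S hS => ?_
  rw [lintegral_obsLaw_eq (rate_pos β hn).le (totalWeight_pos hn w1 w2 w3 w4)
    (hc.trans_le (hgc z₀ S)) hp]
  have := hp.isStandardized.isProbabilityMeasure
  have hi := (integrable_linear_pi hp.isStandardized.integrable (noiseCoeff β z₀ g n S) 0).abs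
  simp only [zero_add] at hi
  refine ENNReal.ofReal_le_ofReal ?_
  calc _ ≤ ∫ ξ, (|normalizedBias β z₀ g n S| + |∑ k, noiseCoeff β z₀ g n S k * ξ k|)
          ∂(Measure.pi fun _ => noiseLaw p) :=
        integral_mono (integrable_linear_pi hp.isStandardized.integrable _ _).abs
          ((integrable_const _).add hi) fun ξ => abs_add_le _ _
    _ = |normalizedBias β z₀ g n S| + ∫ ξ, |∑ k, noiseCoeff β z₀ g n S k * ξ k|
          ∂(Measure.pi fun _ => noiseLaw p) := by
        rw [integral_add (integrable_const _) hi]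
        simp
    _ ≤ _ := by linarith [hbias S hS, (abs_le.1 (hnoise S hS p hp)).2]

lemma eventually_le_risk (hβ : 0 < β) (hz₀ : 0 < z₀) (hz₁ : z₀ < 1) (hg : IsScale β z₀ g)
    {ε L : ℝ} (hε : 0 < ε)
    (hL : IsNoiseDensity ε L (gaussianPDFReal 0 1)) {δ : ℝ} (hδ : 0 < δ) (hδ1 : δ < 1)
    {τ : ℝ} (hτ : 0 < τ) :
    ∀ᶠ n in atTop, ENNReal.ofReal (gaussianAbsMoment / √2 - τ)
      ≤ risk β z₀ g ε L δ n (kernelEstimator β z₀ n) := by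
  obtain ⟨c, C, hc, hgc⟩ := hg.bounds
  filter_upwards [eventually_window hβ hz₀ hz₁,
    eventually_abs_integral_noise_sub_le hβ hz₀ hz₁ hg hε hL hδ hδ1 hτ]
    with n ⟨hn, w1, w2, w3, w4⟩ hnoise
  have h0 := zero_mem_weakHolder β z₀ hδ
  -- The supremum is bounded below by its value at the Gaussian density and the zero function.
  refine le_trans ?_ (le_iSup₂_of_le _ hL (le_iSup₂_of_le 0 h0 le_rfl))
  rw [lintegral_obsLaw_eq (rate_pos β hn).le (totalWeight_pos hn w1 w2 w3 w4)
    (hc.trans_le (hgc z₀ 0).1) hL]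
  refine ENNReal.ofReal_le_ofReal ?_
  have hb : normalizedBias β z₀ g n 0 = 0 := by
    have hval (x : unitInterval) : value 0 x = 0 := rfl
    simp [normalizedBias, hval]
  simp only [hb, zero_add]
  linarith [(abs_le.1 (hnoise 0 h0 _ hL)).1]

end HeteroReg

end

theorem theorem4 (β : ℝ) (hβ₁ : 1 < β) (hβ₂ : β ≤ 2)
    (z₀ : unitInterval) (hz₀ : 0 < z₀) (hz₁ : z₀ < 1)
    (g : unitInterval → HeteroReg.C1 → ℝ) (hg : HeteroReg.IsScale β z₀ g)
    (ε L : ℝ) (hε : 0 < ε)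
    (hL : HeteroReg.IsNoiseDensity ε L (gaussianPDFReal 0 1)) :
    limsup (fun δ : ℝ =>
        limsup (fun n : ℕ =>
          HeteroReg.risk β z₀ g ε L δ n (HeteroReg.kernelEstimator β z₀ n)) atTop)
      (𝓝[>] 0) ≤ HeteroReg.sharpConstant ∧
    ∀ δ : ℝ, 0 < δ → δ < 1 →
      HeteroReg.sharpConstant ≤
        liminf (fun n : ℕ =>
          HeteroReg.risk β z₀ g ε L δ n (HeteroReg.kernelEstimator β z₀ n)) atTop := by
  have hβ : 0 < β := one_pos.trans hβ₁
  refine ⟨?_, fun δ hδ hδ1 => ?_⟩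
  · obtain ⟨c, C, hc, hgc⟩ := hg.bounds
    have hlim : Tendsto (fun δ : ℝ => ENNReal.ofReal
        (HeteroReg.gaussianAbsMoment / √2 + (δ / c + 2 * δ))) (𝓝[>] 0)
        (𝓝 HeteroReg.sharpConstant) := by
      refine ENNReal.tendsto_ofReal (Tendsto.mono_left ?_ nhdsWithin_le_nhds)
      have : ContinuousAt (fun δ : ℝ => HeteroReg.gaussianAbsMoment / √2 + (δ / c + 2 * δ)) 0 := by
        fun_prop
      simpa [ContinuousAt] using! this
    -- The constant is rewritten as the upper limit of the explicit bounds, so that the comparison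
    -- is needed only for small `δ`.
    rw [← hlim.limsup_eq]
    refine limsup_le_limsup ?_
    filter_upwards [Ioo_mem_nhdsGT one_pos] with δ ⟨hδ, hδ1⟩
    exact limsup_le_of_le (h := HeteroReg.eventually_risk_le hβ hz₀ hz₁ hg hc
      (fun x S => (hgc x S).1) hε hL hδ hδ1)
  · have hlim : Tendsto (fun τ : ℝ => ENNReal.ofReal (HeteroReg.gaussianAbsMoment / √2 - τ))
        (𝓝[>] 0) (𝓝 HeteroReg.sharpConstant) := by
      refine ENNReal.tendsto_ofReal (Tendsto.mono_left ?_ nhdsWithin_le_nhds)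
      have : ContinuousAt (fun τ : ℝ => HeteroReg.gaussianAbsMoment / √2 - τ) 0 := by fun_prop
      simpa [ContinuousAt] using! this
    refine le_of_tendsto hlim ?_
    filter_upwards [self_mem_nhdsWithin] with τ hτ
    exact le_liminf_of_le (h := HeteroReg.eventually_le_risk hβ hz₀ hz₁ hg hε hL hδ hδ1 hτ)
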